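/- **Setting.** There are $n\ge 1$ agents on an undirected graph $\mathcal G$. Agent $j$ has a twice differentiable loss $f_j:\mathbb R^d\to\mathbb R$ with $\sigma I\preceq\nabla^2 f_j(x)\preceq L I$ for all $x$, where $0<\sigma\le L$. Put $\kappa=L/\sigma$ and $f=\frac1n\sum_j f_j$. Let $y^{\rm opt}$ be the minimizer of $f$ and $\beta=\max_j\sup_x\|\nabla^2 f_j(x)-\nabla^2 f(x)\|$. The mixing matrix $W=[w_{ij}]\in\mathbb R^{n\times n}$ has $w_{ij}=0$ whenever $i\ne j$ are not adjacent in $\mathcal G$, and satisfies $W\mathbf 1=W^\top\mathbf 1=\mathbf 1$. Its mixing rate $\alpha_0=\|W-\frac1n\mathbf 1\mathbf 1^\top\|$ (spectral norm) satisfies $\alpha_0<1$. **Network-DANE** with parameters $K\in\mathbb N$ and $\mu$ starts from arbitrary $x_j^{(0)}\in\mathbb R^d$, with $y_j^{(0)}=x_j^{(0)}$ and $s_j^{(0)}=\nabla f_j(y_j^{(0)})$. In iteration $t=1,2,\dots$ the agents first perform $K$ communication rounds: starting from $x^{(t-1)}$ and $s^{(t-1)}$, each round replaces $y_j$ by $\sum_i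 w_{ji}y_i$ and $s_j$ by $\sum_i w_{ji}s_i$, and the results are $y_j^{(t)}$ and $\tilde s_j^{(t)}$. Then $$s_j^{(t)}=\tilde s_j^{(t)}+\nabla f_j(y_j^{(t)})-\nabla f_j(y_j^{(t-1)}),\qquad x_j^{(t)}=\arg\min_z\Big\{f_j(z)-\langle\nabla f_j(y_j^{(t)})-s_j^{(t)},z\rangle+\tfrac\mu2\|z-y_j^{(t)}\|_2^2\Big\}.$$ With $\bar y^{(t)}=\frac1n\sum_j y_j^{(t)}$, the error after $t$ iterations is $$E_t=\max\Big\{\sqrt n\,\|\bar y^{(t)}-y^{\rm opt}\|_2,\ \Big(\sum_j\|y_j^{(t)}-\bar y^{(t)}\|_2^2\Big)^{1/2},\ L^{-1}\Big(\sum_j\|s_j^{(t)}-\nabla f(y_j^{(t)})\|_2^2\Big)^{1/2}\Big\},$$ and $\varepsilon$-accuracy means $E_t\le\varepsilon$. **Theorem.** There is an absolute constant $C\ge1$ such that the following holds in this setting (for all $n$, $d$, $\mathcal G$, $W$, $f_j$, $\sigma$, $L$ and all starting points) whenever $$\alpha_0^K\le\frac1{2\kappa}\qquad\text{and}\qquad\sigma+\mu\ge360L\Big(\frac\beta\sigma+1\Big).$$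 1. For all $t\ge0$, $\displaystyle E_t\le C\,E_0\Big(1-\frac{\sigma}{C(\sigma+\mu)}\Big)^t.$ 2. Let $\Lambda\ge1$ be such that $\sigma+\mu\le\Lambda\cdot360L(\beta/\sigma+1)$. Then for every $\varepsilon>0$ there is a number of iterations $$T\le C\Lambda\,\kappa\Big(\frac\beta\sigma+1\Big)\log\Big(2+\frac{E_0}\varepsilon\Big)$$ such that $E_t\le\varepsilon$ for all $t\ge T$. If moreover $K\le\Lambda K_0$, where $K_0$ is the least integer with $\alpha_0^{K_0}\le1/(2\kappa)$, then these $T$ iterations use at most $$C\Lambda^2\,\log(2\kappa)\cdot\frac{\kappa(\beta/\sigma+1)\log(2+E_0/\varepsilon)}{1-\alpha_0}$$ communication rounds. Thus, for $\mu$ and $K$ of the order of their smallest admissible values, $\varepsilon$-accuracy is reached in $O(\kappa(\beta/\sigma+1)\log(1/\varepsilon))$ iterations, and for $\kappa$ bounded away from $1$ (so that $\log(2\kappa)=O(\log\kappa)$) in $O\big(\log\kappa\cdot\kappa(\beta/\sigma+1)\log(1/\varepsilon)/(1-\alpha_0)\big)$ communication rounds. -/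

import Mathlib

namespace NetworkDane

noncomputable section

/-- The parameter space `ℝ^d` with its Euclidean norm. -/
abbrev Vec (d : ℕ) : Type := EuclideanSpace ℝ (Fin d)

/-- The Hessian of `g` at `x`, as a linear operator: the derivative of the gradient. -/
def hess {d : ℕ} (g : Vec d → ℝ) (x : Vec d) : Vec d →L[ℝ] Vec d :=
  fderiv ℝ (gradient g) x

/-- `g` is twice differentiable and `σ I ≼ ∇² g(x) ≼ L I` for every `x`. -/
structure HessianBetween {d : ℕ} (σ L : ℝ) (g : Vec d → ℝ) : Prop where
  differentiable : Differentiable ℝ g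
  differentiable_gradient : Differentiable ℝ (gradient g)
  lower : ∀ x v : Vec d, σ * ‖v‖ ^ 2 ≤ inner ℝ (hess g x v) v
  upper : ∀ x v : Vec d, inner ℝ (hess g x v) v ≤ L * ‖v‖ ^ 2

/-- The average `(1/n) ∑_j v_j` of the blocks of a stacked vector. -/
def avg {n d : ℕ} (v : Fin n → Vec d) : Vec d :=
  (n : ℝ)⁻¹ • ∑ j, v j

/-- The Euclidean norm of the `nd`-dimensional stacked vector with blocks `v_1, …, v_n`. -/
def stackNorm {n d : ℕ} (v : Fin n → Vec d) : ℝ :=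
  Real.sqrt (∑ j, ‖v j‖ ^ 2)

/-- The global loss `f = (1/n) ∑_j f_j`. -/
def globalLoss {n d : ℕ} (f : Fin n → Vec d → ℝ) (x : Vec d) : ℝ :=
  (n : ℝ)⁻¹ * ∑ j, f j x

/-- The homogeneity parameter `β = max_j sup_x ‖∇² f_j(x) - ∇² f(x)‖` (operator norm). -/
def homogeneity {n d : ℕ} (f : Fin n → Vec d → ℝ) : ℝ :=
  ⨆ j, ⨆ x, ‖hess (f j) x - hess (globalLoss f) x‖

/-- `W` is a mixing matrix for the undirected graph `G`: its weights vanish between distinct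
agents that are not adjacent, and its rows and columns sum to one. -/
structure IsMixing {n : ℕ} (G : SimpleGraph (Fin n)) (W : Matrix (Fin n) (Fin n) ℝ) : Prop where
  support : ∀ i j, i ≠ j → ¬ G.Adj i j → W i j = 0
  row_sum : ∀ i, ∑ j, W i j = 1
  col_sum : ∀ j, ∑ i, W i j = 1

/-- The mixing rate `α₀ = ‖W - (1/n) 1 1ᵀ‖` (spectral norm). -/
def mixingRate {n : ℕ} (W : Matrix (Fin n) (Fin n) ℝ) : ℝ :=
  ‖Matrix.toEuclideanCLM (n := Fin n) (𝕜 := ℝ) (W - Matrix.of fun _ _ => (n : ℝ)⁻¹)‖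

/-- What the agents hold during the averaging loop: their parameter estimates, their gradient
estimates, and the number of communication rounds used so far. -/
structure MixState (n d : ℕ) where
  y : Fin n → Vec d
  s : Fin n → Vec d
  rounds : ℕ

/-- One communication round: every agent receives the estimates of its neighbours once and
replaces its own by the weighted sums. (Only neighbours and the agent itself have nonzero
weight.) -/
def gossip {n d : ℕ} (W : Matrix (Fin n) (Fin n) ℝ) (m : MixState n d) : MixState n d where
  y := fun j => ∑ i, W j i • m.y i
  s := fun j => ∑ i, W j i • m.s i
  rounds := m.rounds + 1

/-- The variables of all agents at the end of an iteration, and the number of communication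
rounds used so far. -/
structure State (n d : ℕ) where
  x : Fin n → Vec d
  y : Fin n → Vec d
  s : Fin n → Vec d
  rounds : ℕ

/-- The initialization: `x_j` arbitrary, `y_j = x_j`, `s_j = ∇ f_j(y_j)`. -/
structure IsInit {n d : ℕ} (f : Fin n → Vec d → ℝ) (p : State n d) : Prop where
  y_eq : p.y = p.x
  s_eq : ∀ j, p.s j = gradient (f j) (p.y j)
  rounds_eq : p.rounds = 0

/-- The objective of the local subproblem of an agent with loss `g`, current parameter estimate
`y` and gradient estimate `s`. -/
def localObjective {d : ℕ} (g : Vec d → ℝ) (μ : ℝ) (y s z : Vec d) : ℝ :=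
  g z - inner ℝ (gradient g y - s) z + μ / 2 * ‖z - y‖ ^ 2

/-- `q` results from `p` by one iteration of Network-DANE with `K` communication rounds:
averaging of `x` and `s`, gradient tracking, and the local minimizations. -/
structure IsStep {n d : ℕ} (f : Fin n → Vec d → ℝ) (W : Matrix (Fin n) (Fin n) ℝ) (K : ℕ) (μ : ℝ)
    (p q : State n d) : Prop where
  y_eq : q.y = ((gossip W)^[K] ⟨p.x, p.s, p.rounds⟩).y
  s_eq : ∀ j, q.s j = ((gossip W)^[K] ⟨p.x, p.s, p.rounds⟩).s j +
    (gradient (f j) (q.y j) - gradient (f j) (p.y j))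
  x_min : ∀ j, IsMinOn (localObjective (f j) μ (q.y j) (q.s j)) Set.univ (q.x j)
  rounds_eq : q.rounds = ((gossip W)^[K] ⟨p.x, p.s, p.rounds⟩).rounds

/-- `p 0, p 1, p 2, …` is a run of Network-DANE. -/
structure IsRun {n d : ℕ} (f : Fin n → Vec d → ℝ) (W : Matrix (Fin n) (Fin n) ℝ) (K : ℕ) (μ : ℝ)
    (p : ℕ → State n d) : Prop where
  init : IsInit f (p 0)
  step : ∀ t, IsStep f W K μ (p t) (p (t + 1))

/-- The error metric: the maximum of the convergence error `√n ‖ȳ - y_opt‖`, the consensus error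
`‖y - 1 ⊗ ȳ‖` and the scaled gradient estimation error `L⁻¹ ‖s - ∇f(y)‖`. -/
def err {n d : ℕ} (f : Fin n → Vec d → ℝ) (L : ℝ) (yopt : Vec d) (p : State n d) : ℝ :=
  max (Real.sqrt n * ‖avg p.y - yopt‖)
    (max (stackNorm fun j => p.y j - avg p.y)
      (L⁻¹ * stackNorm fun j => p.s j - gradient (globalLoss f) (p.y j)))

end

end NetworkDane

/-! Write a, b, c for the convergence, consensus and scaled gradient estimation errors, β for the
homogeneity, and l = L/(σ+μ), r = σ/(σ+μ). Let z be the proximal point of f at ȳ. An exact proximal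
step contracts a by 1 - r, so the task is to show that the local minimizers x_j imitate z well
enough.

Their optimality conditions put them within ‖w‖/(σ+μ) of z, where the residual w contains only b, c
and β times distances (`local_minimization_bounds`). Gradient tracking makes the average of w
vanish, so x̄ is closer to z than the individual x_j by a further factor 2l. Communication then at
least halves the consensus error, and moving y costs the gradient estimate only β times the
displacement (`IsStep.mixing_bounds`).

The quantity V = a + b + 2lc shrinks by 1 - r/2 per iteration (`weighted_error_contraction`): every
disturbance of V involving a carries a multiple of β/(σ+μ) · l, which is at most r/360 by the choice
of μ. Since V gives c only the small weight 2l, c is recovered with an absolute constant from c' ≤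
(3/5)c + 7V (`geometric_decay`). Taking logarithms gives the iteration and round counts. -/

namespace NetworkDane

/-! ### Consequences of the Hessian bounds -/

section Calculus

variable {n d : ℕ} {σ L : ℝ} {g : Vec d → ℝ}

/-- The real Riesz map `v ↦ ⟨v, ·⟩` as a continuous linear map. -/
noncomputable def riesz (d : ℕ) : Vec d →L[ℝ] StrongDual ℝ (Vec d) :=
  LinearMap.toContinuousLinearMap
    { toFun := fun v => InnerProductSpace.toDual ℝ (Vec d) v
      map_add' := fun v w => map_add _ v w
      map_smul' := fun c v => by simp }

theorem hasFDerivAt_fderiv (hg : Differentiable ℝ (gradient g)) (x : Vec d) :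
    HasFDerivAt (fderiv ℝ g) ((riesz d).comp (hess g x)) x := by
  have h : fderiv ℝ g = riesz d ∘ gradient g := by
    funext x
    exact toDual_gradient.symm
  rw [h]
  exact (riesz d).hasFDerivAt.comp x (hg x).hasFDerivAt

/-- Symmetry of the second derivative holds for a twice differentiable function without continuity
of the Hessian. -/
theorem HessianBetween.symmetric (hg : HessianBetween σ L g) (x v w : Vec d) :
    inner ℝ (hess g x v) w = inner ℝ v (hess g x w) := by
  rw [real_inner_comm (hess g x w) v]
  exact second_derivative_symmetric (fun y => (hg.differentiable y).hasFDerivAt)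
    (hasFDerivAt_fderiv hg.differentiable_gradient x) v w

/-- A symmetric operator with quadratic form between `0` and `L` has norm at most `L`. -/
theorem norm_le_of_symmetric_of_inner_le {T : Vec d →L[ℝ] Vec d} (hL : 0 < L)
    (hs : ∀ v w, inner ℝ (T v) w = inner ℝ v (T w))
    (h0 : ∀ v, 0 ≤ inner ℝ (T v) v) (h1 : ∀ v, inner ℝ (T v) v ≤ L * ‖v‖ ^ 2) : ‖T‖ ≤ L := by
  refine ContinuousLinearMap.opNorm_le_bound _ hL.le fun v => ?_
  have hpol : ∀ w, 4 * inner ℝ (T v) w ≤ L * ‖v + w‖ ^ 2 := by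
    intro w
    have e1 := h1 (v + w)
    have e0 := h0 (v - w)
    simp only [map_add, map_sub, inner_add_left, inner_add_right, inner_sub_left,
      inner_sub_right] at e1 e0
    have e2 : inner ℝ (T w) v = inner ℝ (T v) w := by rw [hs, real_inner_comm]
    linarith
  -- With q = ‖T v‖ / L this choice turns the polarization bound into (2q)² ≤ (‖v‖ + q)², hence q ≤
  -- ‖v‖.
  have h := hpol (L⁻¹ • T v)
  rw [inner_smul_right, real_inner_self_eq_norm_sq] at h
  have hn : ‖v + L⁻¹ • T v‖ ≤ ‖v‖ + L⁻¹ * ‖T v‖ := by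
    refine (norm_add_le _ _).trans ?_
    rw [norm_smul, Real.norm_of_nonneg (by positivity)]
  have hsq : ‖v + L⁻¹ • T v‖ ^ 2 ≤ (‖v‖ + L⁻¹ * ‖T v‖) ^ 2 := by gcongr
  have h2 : 4 * (L⁻¹ * ‖T v‖ ^ 2) ≤ L * (‖v‖ + L⁻¹ * ‖T v‖) ^ 2 :=
    h.trans (by gcongr)
  have e : ‖T v‖ = L * (L⁻¹ * ‖T v‖) := by field_simp
  set q := L⁻¹ * ‖T v‖ with hq
  have hq0 : 0 ≤ q := by positivity
  have h3 : L * (2 * q) ^ 2 ≤ L * (‖v‖ + q) ^ 2 := by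
    have : 4 * (L⁻¹ * ‖T v‖ ^ 2) = L * (2 * q) ^ 2 := by rw [hq]; field_simp; ring
    linarith
  have h4 : 2 * q ≤ ‖v‖ + q :=
    le_of_sq_le_sq (le_of_mul_le_mul_left h3 hL) (by positivity)
  rw [e]
  gcongr
  linarith

theorem HessianBetween.norm_hess_le (hg : HessianBetween σ L g) (hσ : 0 < σ) (hL : σ ≤ L)
    (x : Vec d) : ‖hess g x‖ ≤ L :=
  norm_le_of_symmetric_of_inner_le (hσ.trans_le hL) (hg.symmetric x)
    (fun v => le_trans (by positivity) (hg.lower x v)) (hg.upper x)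

theorem HessianBetween.norm_gradient_sub_le (hg : HessianBetween σ L g) (hσ : 0 < σ) (hL : σ ≤ L)
    (x y : Vec d) : ‖gradient g x - gradient g y‖ ≤ L * ‖x - y‖ :=
  convex_univ.norm_image_sub_le_of_norm_fderiv_le (𝕜 := ℝ)
    (fun z _ => hg.differentiable_gradient z)
    (fun z _ => hg.norm_hess_le hσ hL z) (Set.mem_univ y) (Set.mem_univ x)

/-- Mean value inequality along the segment from `y` to `x`. -/
theorem HessianBetween.le_inner_gradient_sub (hg : HessianBetween σ L g) (x y : Vec d) :
    σ * ‖x - y‖ ^ 2 ≤ inner ℝ (gradient g x - gradient g y) (x - y) := by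
  have hd : ∀ t : ℝ, HasDerivAt (fun t : ℝ => inner ℝ (gradient g (y + t • (x - y))) (x - y))
      (inner ℝ (hess g (y + t • (x - y)) (x - y)) (x - y)) t := by
    intro t
    have h1 : HasDerivAt (fun t : ℝ => y + t • (x - y)) (x - y) t := by
      simpa using ((hasDerivAt_id t).smul_const (x - y)).const_add y
    have h2 := (hg.differentiable_gradient (y + t • (x - y))).hasFDerivAt.comp_hasDerivAt t h1
    simpa [hess] using h2.inner ℝ (hasDerivAt_const t (x - y))
  have h := mul_sub_le_image_sub_of_le_deriv (fun t => (hd t).differentiableAt)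
    (C := σ * ‖x - y‖ ^ 2) (fun t => by rw [(hd t).deriv]; exact hg.lower _ _) zero_le_one
  simpa [inner_sub_left] using h

theorem gradient_eq_zero_of_isMinOn {x : Vec d} (h : IsMinOn g Set.univ x) : gradient g x = 0 := by
  have : IsLocalMin g x := h.isLocalMin Filter.univ_mem
  simp [gradient, this.fderiv_eq_zero]

theorem gradient_add_smul_eq {x y s : Vec d} {μ : ℝ} (hg : Differentiable ℝ g)
    (h : IsMinOn (localObjective g μ y s) Set.univ x) :
    gradient g x - gradient g y + s + μ • (x - y) = 0 := by
  have h0 := gradient_eq_zero_of_isMinOn h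
  have h1 : HasGradientAt (localObjective g μ y s)
      (gradient g x - (gradient g y - s) + μ • (x - y)) x := by
    rw [hasGradientAt_iff_hasFDerivAt]
    have e1 := hasGradientAt_iff_hasFDerivAt.mp (hg x).hasGradientAt
    have e2 : HasFDerivAt (fun z => inner ℝ (gradient g y - s) z)
        (InnerProductSpace.toDual ℝ (Vec d) (gradient g y - s)) x :=
      (InnerProductSpace.toDual ℝ (Vec d) (gradient g y - s)).hasFDerivAt
    have e3 := (((hasFDerivAt_id x).sub_const y).norm_sq).const_mul (μ / 2)
    refine ((e1.sub e2).add e3).congr_fderiv ?_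
    ext v
    simp
    ring
  rw [h1.gradient] at h0
  rw [← h0]
  abel

/-- Coercivity gives a minimizer. Taking the gradient estimate equal to the true gradient removes
the linear term of `localObjective`, leaving the proximal objective. -/
theorem exists_prox {μ m : ℝ} (hμ : 0 < μ) (hg : Differentiable ℝ g) (hm : ∀ z, m ≤ g z)
    (y : Vec d) : ∃ x, gradient g x + μ • (x - y) = 0 := by
  have hc : Continuous (localObjective g μ y (gradient g y)) := by
    unfold localObjective
    have := hg.continuous
    fun_prop
  have ht : Filter.Tendsto (localObjective g μ y (gradient g y)) (Filter.cocompact _)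
      Filter.atTop := by
    have h1 : Filter.Tendsto (fun z : Vec d => m + μ / 2 * ‖z - y‖ ^ 2) (Filter.cocompact _)
        Filter.atTop := by
      refine Filter.tendsto_atTop_add_const_left _ _ ?_
      refine Filter.Tendsto.const_mul_atTop (by positivity) ?_
      refine (Filter.tendsto_pow_atTop two_ne_zero).comp ?_
      have := tendsto_norm_cocompact_atTop (E := Vec d)
      exact this.comp (Homeomorph.subRight y).isClosedEmbedding.tendsto_cocompact
    refine Filter.tendsto_atTop_mono (fun z => ?_) h1
    simp [localObjective, hm z]
  obtain ⟨x, hx⟩ := hc.exists_forall_le ht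
  refine ⟨x, ?_⟩
  have := gradient_add_smul_eq hg (x := x) (isMinOn_univ_iff.mpr hx)
  rwa [sub_add_cancel] at this

variable {f : Fin n → Vec d → ℝ}

theorem gradient_globalLoss (hf : ∀ j, Differentiable ℝ (f j)) :
    gradient (globalLoss f) = fun x => avg fun j => gradient (f j) x := by
  refine gradient_eq fun x => ?_
  rw [hasGradientAt_iff_hasFDerivAt]
  have h : ∀ j ∈ Finset.univ, HasFDerivAt (f j)
      (InnerProductSpace.toDual ℝ (Vec d) (gradient (f j) x)) x := fun j _ =>
    hasGradientAt_iff_hasFDerivAt.mp (hf j x).hasGradientAt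
  have h2 := (HasFDerivAt.fun_sum h).const_mul ((n : ℝ)⁻¹)
  refine h2.congr_fderiv ?_
  simp [avg]

theorem hess_globalLoss (hf : ∀ j, HessianBetween σ L (f j)) (x : Vec d) :
    hess (globalLoss f) x = (n : ℝ)⁻¹ • ∑ j, hess (f j) x := by
  rw [hess, gradient_globalLoss fun j => (hf j).differentiable]
  have h : HasFDerivAt (fun x => ∑ j, gradient (f j) x) (∑ j, hess (f j) x) x :=
    HasFDerivAt.fun_sum fun j _ => ((hf j).differentiable_gradient x).hasFDerivAt
  exact (h.const_smul ((n : ℝ)⁻¹)).fderiv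

theorem HessianBetween.globalLoss (hn : 0 < n) (hf : ∀ j, HessianBetween σ L (f j)) :
    HessianBetween σ L (globalLoss f) := by
  have hn' : (0 : ℝ) < n := by exact_mod_cast hn
  have hin : ∀ x v : Vec d, inner ℝ (hess (NetworkDane.globalLoss f) x v) v =
      (n : ℝ)⁻¹ * ∑ j, inner ℝ (hess (f j) x v) v := by
    intro x v
    simp [hess_globalLoss hf, inner_smul_left, sum_inner]
  refine ⟨?_, ?_, fun x v => ?_, fun x v => ?_⟩
  · unfold NetworkDane.globalLoss
    exact (Differentiable.fun_sum fun j _ => (hf j).differentiable).const_mul _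
  · rw [gradient_globalLoss fun j => (hf j).differentiable]
    unfold avg
    exact (Differentiable.fun_sum fun j _ => (hf j).differentiable_gradient).const_smul
      ((n : ℝ)⁻¹)
  · rw [hin, inv_mul_eq_div, le_div_iff₀ hn']
    have := Finset.sum_le_sum fun j (_ : j ∈ Finset.univ) => (hf j).lower x v
    simpa [mul_comm] using this
  · rw [hin, inv_mul_eq_div, div_le_iff₀ hn']
    have := Finset.sum_le_sum fun j (_ : j ∈ Finset.univ) => (hf j).upper x v
    simpa [mul_comm] using this

theorem norm_hess_sub_le (hn : 0 < n) (hσ : 0 < σ) (hL : σ ≤ L)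
    (hf : ∀ j, HessianBetween σ L (f j)) (j : Fin n) (x : Vec d) :
    ‖hess (f j) x - hess (globalLoss f) x‖ ≤ 2 * L := by
  refine (norm_sub_le _ _).trans ?_
  linarith [(hf j).norm_hess_le hσ hL x, (HessianBetween.globalLoss hn hf).norm_hess_le hσ hL x]

theorem norm_hess_sub_le_homogeneity (hn : 0 < n) (hσ : 0 < σ) (hL : σ ≤ L)
    (hf : ∀ j, HessianBetween σ L (f j)) (j : Fin n) (x : Vec d) :
    ‖hess (f j) x - hess (globalLoss f) x‖ ≤ homogeneity f := by
  -- Boundedness is essential: a real supremum over an unbounded set has the default value 0 and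
  -- would bound nothing.
  have hb : ∀ i, BddAbove (Set.range fun x => ‖hess (f i) x - hess (globalLoss f) x‖) := by
    intro i
    refine ⟨2 * L, ?_⟩
    rintro _ ⟨z, rfl⟩
    exact norm_hess_sub_le hn hσ hL hf i z
  exact (le_ciSup (hb j) x).trans
    (le_ciSup (f := fun i => ⨆ x, ‖hess (f i) x - hess (globalLoss f) x‖)
      (Set.finite_range _).bddAbove j)

theorem homogeneity_nonneg : 0 ≤ homogeneity f :=
  Real.iSup_nonneg fun _ => Real.iSup_nonneg fun _ => norm_nonneg _

theorem homogeneity_le (hn : 0 < n) (hσ : 0 < σ) (hL : σ ≤ L)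
    (hf : ∀ j, HessianBetween σ L (f j)) : homogeneity f ≤ 2 * L := by
  have : Nonempty (Fin n) := ⟨⟨0, hn⟩⟩
  exact ciSup_le fun j => ciSup_le fun x => norm_hess_sub_le hn hσ hL hf j x

/-- The only way β enters the analysis: it is a Lipschitz constant of ∇f_j - ∇f. -/
theorem norm_gradient_sub_gradient_sub_le (hn : 0 < n) (hσ : 0 < σ) (hL : σ ≤ L)
    (hf : ∀ j, HessianBetween σ L (f j)) (j : Fin n) (x y : Vec d) :
    ‖(gradient (f j) x - gradient (globalLoss f) x) -
      (gradient (f j) y - gradient (globalLoss f) y)‖ ≤ homogeneity f * ‖x - y‖ := by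
  have h1 := (hf j).differentiable_gradient
  have h2 := (HessianBetween.globalLoss hn hf).differentiable_gradient
  refine convex_univ.norm_image_sub_le_of_norm_fderiv_le (𝕜 := ℝ)
    (f := fun x => gradient (f j) x - gradient (globalLoss f) x)
    (fun z _ => (h1 z).sub (h2 z)) (fun z _ => ?_) (Set.mem_univ y) (Set.mem_univ x)
  rw [fderiv_fun_sub (h1 z) (h2 z)]
  exact norm_hess_sub_le_homogeneity hn hσ hL hf j z

end Calculus

end NetworkDane

namespace NetworkDane

/-! ### Stacked vectors and their averages -/

section Stacked

variable {n d : ℕ}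

theorem stackNorm_eq_norm (v : Fin n → Vec d) :
    stackNorm v = ‖(WithLp.toLp 2 v : PiLp 2 fun _ : Fin n => Vec d)‖ :=
  (PiLp.norm_eq_of_L2 _).symm

theorem stackNorm_nonneg (v : Fin n → Vec d) : 0 ≤ stackNorm v := Real.sqrt_nonneg _

theorem sq_stackNorm (v : Fin n → Vec d) : stackNorm v ^ 2 = ∑ j, ‖v j‖ ^ 2 :=
  Real.sq_sqrt (by positivity)

theorem stackNorm_add_le (v w : Fin n → Vec d) :
    stackNorm (fun j => v j + w j) ≤ stackNorm v + stackNorm w := by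
  simp only [stackNorm_eq_norm]
  exact norm_add_le (WithLp.toLp 2 v : PiLp 2 fun _ : Fin n => Vec d) (WithLp.toLp 2 w)

theorem stackNorm_le_mul {v w : Fin n → Vec d} {c : ℝ} (hc : 0 ≤ c)
    (h : ∀ j, ‖v j‖ ≤ c * ‖w j‖) : stackNorm v ≤ c * stackNorm w := by
  refine le_of_sq_le_sq ?_ (mul_nonneg hc (stackNorm_nonneg w))
  rw [mul_pow, sq_stackNorm, sq_stackNorm, Finset.mul_sum]
  refine Finset.sum_le_sum fun j _ => ?_
  rw [← mul_pow]
  exact pow_le_pow_left₀ (norm_nonneg _) (h j) 2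

theorem stackNorm_const (c : Vec d) : stackNorm (fun _ : Fin n => c) = Real.sqrt n * ‖c‖ := by
  simp [stackNorm]

theorem stackNorm_sub_comm (v w : Fin n → Vec d) :
    stackNorm (fun j => v j - w j) = stackNorm (fun j => w j - v j) := by
  simp only [stackNorm, norm_sub_rev]

theorem avg_add (v w : Fin n → Vec d) : avg (fun j => v j + w j) = avg v + avg w := by
  simp [avg, Finset.sum_add_distrib]

theorem avg_sub (v w : Fin n → Vec d) : avg (fun j => v j - w j) = avg v - avg w := by
  simp [avg, Finset.sum_sub_distrib, smul_sub]

theorem avg_smul (c : ℝ) (v : Fin n → Vec d) : avg (fun j => c • v j) = c • avg v := by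
  simp only [avg, ← Finset.smul_sum]
  exact smul_comm _ _ _

theorem avg_const (hn : 0 < n) (c : Vec d) : avg (fun _ : Fin n => c) = c := by
  have : (n : ℝ) ≠ 0 := by positivity
  simp [avg, ← Nat.cast_smul_eq_nsmul ℝ, smul_smul, this]

theorem sum_sub_avg (hn : 0 < n) (v : Fin n → Vec d) : ∑ j, (v j - avg v) = 0 := by
  have : (n : ℝ) ≠ 0 := by positivity
  simp [avg, ← Nat.cast_smul_eq_nsmul ℝ, smul_smul, this]

/-- Pythagoras: deviations from the average are orthogonal to consensus vectors. -/
theorem sq_stackNorm_sub (hn : 0 < n) (v : Fin n → Vec d) (c : Vec d) :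
    stackNorm (fun j => v j - c) ^ 2 =
      stackNorm (fun j => v j - avg v) ^ 2 + n * ‖avg v - c‖ ^ 2 := by
  simp only [sq_stackNorm]
  have h : ∀ j, ‖v j - c‖ ^ 2 = ‖v j - avg v‖ ^ 2 + 2 * inner ℝ (v j - avg v) (avg v - c)
      + ‖avg v - c‖ ^ 2 := by
    intro j
    rw [← norm_add_sq_real, sub_add_sub_cancel]
  simp only [h, Finset.sum_add_distrib, ← Finset.mul_sum, ← sum_inner, sum_sub_avg hn]
  simp

theorem stackNorm_sub_avg_le (hn : 0 < n) (v : Fin n → Vec d) (c : Vec d) :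
    stackNorm (fun j => v j - avg v) ≤ stackNorm (fun j => v j - c) := by
  refine le_of_sq_le_sq ?_ (stackNorm_nonneg _)
  rw [sq_stackNorm_sub hn v c]
  have : 0 ≤ (n : ℝ) * ‖avg v - c‖ ^ 2 := by positivity
  linarith

theorem sqrt_mul_norm_avg_le (hn : 0 < n) (v : Fin n → Vec d) :
    Real.sqrt n * ‖avg v‖ ≤ stackNorm v := by
  refine le_of_sq_le_sq ?_ (stackNorm_nonneg _)
  have h := sq_stackNorm_sub hn v 0
  simp only [sub_zero] at h
  rw [h, mul_pow, Real.sq_sqrt (by positivity)]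
  nlinarith [stackNorm_nonneg fun j => v j - avg v]

end Stacked

/-! ### Contraction of the consensus error by communication -/

section Mixing

variable {n d : ℕ} {G : SimpleGraph (Fin n)} {W : Matrix (Fin n) (Fin n) ℝ}

/-- The action of a weight matrix on the blocks of a stacked vector. -/
def mix (W : Matrix (Fin n) (Fin n) ℝ) (v : Fin n → Vec d) : Fin n → Vec d :=
  fun j => ∑ i, W j i • v i

theorem gossip_iterate (W : Matrix (Fin n) (Fin n) ℝ) (K : ℕ) (m : MixState n d) :
    (gossip W)^[K] m = ⟨(mix W)^[K] m.y, (mix W)^[K] m.s, m.rounds + K⟩ := by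
  induction K generalizing m with
  | zero => rfl
  | succ K ih =>
    rw [Function.iterate_succ_apply, ih]
    simp only [gossip, Function.iterate_succ_apply, MixState.mk.injEq]
    exact ⟨rfl, rfl, by ring⟩

theorem IsMixing.avg_mix (hW : IsMixing G W) (v : Fin n → Vec d) : avg (mix W v) = avg v := by
  simp only [avg, mix]
  rw [Finset.sum_comm]
  simp only [← Finset.sum_smul, hW.col_sum, one_smul]

theorem IsMixing.stackNorm_mix_sub_avg_le (hn : 0 < n) (hW : IsMixing G W) (v : Fin n → Vec d) :
    stackNorm (fun j => mix W v j - avg v) ≤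
      mixingRate W * stackNorm (fun j => v j - avg v) := by
  have hn' : (n : ℝ) ≠ 0 := by positivity
  have hα : 0 ≤ mixingRate W := norm_nonneg _
  set u : Fin n → Vec d := fun j => v j - avg v with hu
  -- The spectral norm concerns scalar vectors, so each of the d coordinates is treated separately.
  -- Row sums 1 let W commute with centering, and the averaging matrix annihilates centered vectors.
  have hmix : ∀ j k, (mix W v j - avg v) k =
      (Matrix.toEuclideanCLM (n := Fin n) (𝕜 := ℝ) (W - Matrix.of fun _ _ => (n : ℝ)⁻¹)
        (WithLp.toLp 2 fun i => u i k)) j := by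
    intro j k
    have hsum : ∑ i, u i k = 0 := by
      have := congrArg (fun z : Vec d => z k) (sum_sub_avg hn v)
      simpa [hu] using this
    have h1 : ∀ c : ℝ, ∑ i, W j i * c = c := by
      intro c
      rw [← Finset.sum_mul, hW.row_sum, one_mul]
    simp only [Matrix.toEuclideanCLM_toLp, Matrix.mulVec, dotProduct, Matrix.sub_apply,
      Matrix.of_apply, sub_mul, Finset.sum_sub_distrib, ← Finset.mul_sum, hsum]
    simp [hu, mix, mul_sub, Finset.sum_sub_distrib, h1]
  refine le_of_sq_le_sq ?_ (mul_nonneg hα (stackNorm_nonneg _))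
  rw [mul_pow, sq_stackNorm, sq_stackNorm]
  simp only [EuclideanSpace.norm_sq_eq, hmix]
  rw [Finset.sum_comm, Finset.sum_comm (γ := Fin n), Finset.mul_sum]
  refine Finset.sum_le_sum fun k _ => ?_
  have h := (Matrix.toEuclideanCLM (n := Fin n) (𝕜 := ℝ)
    (W - Matrix.of fun _ _ => (n : ℝ)⁻¹)).le_opNorm (WithLp.toLp 2 fun i => u i k)
  have h2 := pow_le_pow_left₀ (norm_nonneg _) h 2
  rw [mul_pow, EuclideanSpace.norm_sq_eq, EuclideanSpace.norm_sq_eq] at h2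
  exact h2

theorem IsMixing.avg_mix_iterate (hW : IsMixing G W) (K : ℕ) (v : Fin n → Vec d) :
    avg ((mix W)^[K] v) = avg v := by
  induction K with
  | zero => rfl
  | succ K ih => rw [Function.iterate_succ_apply', hW.avg_mix, ih]

theorem IsMixing.stackNorm_mix_iterate_sub_avg_le (hn : 0 < n) (hW : IsMixing G W) (K : ℕ)
    (v : Fin n → Vec d) :
    stackNorm (fun j => (mix W)^[K] v j - avg v) ≤
      mixingRate W ^ K * stackNorm (fun j => v j - avg v) := by
  induction K with
  | zero => simp
  | succ K ih =>
    rw [Function.iterate_succ_apply']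
    have h := hW.stackNorm_mix_sub_avg_le hn ((mix W)^[K] v)
    rw [hW.avg_mix_iterate] at h
    refine h.trans ?_
    rw [pow_succ', mul_assoc]
    exact mul_le_mul_of_nonneg_left ih (norm_nonneg _)

end Mixing

end NetworkDane

namespace NetworkDane

/-! ### Error bounds for one iteration -/

section OneStep

variable {n d : ℕ} {σ L μ : ℝ} {f : Fin n → Vec d → ℝ}

/-- Strong monotonicity of ∇g + μ·id combined with Cauchy–Schwarz. -/
theorem HessianBetween.mul_norm_sub_le {g : Vec d → ℝ} (hg : HessianBetween σ L g) {x z w : Vec d}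
    (h : gradient g x - gradient g z + μ • (x - z) = w) : (σ + μ) * ‖x - z‖ ≤ ‖w‖ := by
  have h1 := hg.le_inner_gradient_sub x z
  have h2 : inner ℝ w (x - z) =
      inner ℝ (gradient g x - gradient g z) (x - z) + μ * ‖x - z‖ ^ 2 := by
    rw [← h, inner_add_left, real_inner_smul_left, real_inner_self_eq_norm_sq]
  have h3 := real_inner_le_norm w (x - z)
  rcases (norm_nonneg (x - z)).eq_or_lt with h0 | h0
  · rw [← h0, mul_zero]
    exact norm_nonneg _
  · refine le_of_mul_le_mul_right ?_ h0
    nlinarith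

/-- The effect of the local minimizations. The bounds are relative to the proximal point of the
global loss at the average of the estimates. -/
theorem local_minimization_bounds (hn : 0 < n) (hσ : 0 < σ) (hL : σ ≤ L)
    (hf : ∀ j, HessianBetween σ L (f j)) {yopt : Vec d}
    (hopt : IsMinOn (globalLoss f) Set.univ yopt) (hμ : 0 < μ) {x y s : Fin n → Vec d}
    (htrack : avg s = avg fun j => gradient (f j) (y j))
    (hx : ∀ j, IsMinOn (localObjective (f j) μ (y j) (s j)) Set.univ (x j)) :
    ∃ U : ℝ, 0 ≤ U ∧ stackNorm (fun j => x j - avg x) ≤ U ∧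
      U ≤ (1 + homogeneity f / (σ + μ)) * stackNorm (fun j => y j - avg y) +
        homogeneity f / (σ + μ) * (L / (σ + μ)) * (Real.sqrt n * ‖avg y - yopt‖) +
        L / (σ + μ) * (L⁻¹ * stackNorm fun j => s j - gradient (globalLoss f) (y j)) ∧
      Real.sqrt n * ‖avg x - yopt‖ ≤
        (1 - σ / (σ + μ)) * (Real.sqrt n * ‖avg y - yopt‖) + 2 * (L / (σ + μ)) * U ∧
      Real.sqrt n * ‖avg x - avg y‖ ≤
        2 * (L / (σ + μ)) * U + L / (σ + μ) * (Real.sqrt n * ‖avg y - yopt‖) := by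
  have hM : 0 < σ + μ := by positivity
  have hL0 : 0 < L := hσ.trans_le hL
  have hF := HessianBetween.globalLoss hn hf
  have hβ : 0 ≤ homogeneity f := homogeneity_nonneg
  set F := globalLoss f
  have hgF : ∀ z, gradient F z = avg fun j => gradient (f j) z := fun z =>
    congrFun (gradient_globalLoss fun j => (hf j).differentiable) z
  obtain ⟨z, hz⟩ := exists_prox hμ hF.differentiable
    (fun w => isMinOn_univ_iff.mp hopt w) (avg y)
  have hg0 := gradient_eq_zero_of_isMinOn hopt
  have hz1 : (σ + μ) * ‖z - yopt‖ ≤ μ * ‖avg y - yopt‖ := by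
    have h := hF.mul_norm_sub_le (μ := μ) (x := z) (z := yopt) (w := μ • (avg y - yopt)) (by
      rw [hg0, ← sub_eq_zero]
      refine Eq.trans ?_ hz
      module)
    rwa [norm_smul, Real.norm_of_nonneg hμ.le] at h
  -- Stationarity gives μ‖z - ȳ‖ ≤ L‖z - yopt‖; inserting `hz1` lets μ cancel.
  have hz2 : (σ + μ) * ‖z - avg y‖ ≤ L * ‖avg y - yopt‖ := by
    have h1 := hF.norm_gradient_sub_le hσ hL z yopt
    have h2 : gradient F z - gradient F yopt = -(μ • (z - avg y)) := by
      rw [hg0, sub_zero, eq_neg_iff_add_eq_zero, hz]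
    rw [h2, norm_neg, norm_smul, Real.norm_of_nonneg hμ.le] at h1
    refine le_of_mul_le_mul_left ?_ hμ
    nlinarith
  -- The residual left when the equation of z is subtracted from the optimality condition of x_j.
  set w : Fin n → Vec d := fun j => μ • (y j - avg y) +
    ((gradient (f j) (y j) - gradient F (y j)) - (gradient (f j) z - gradient F z)) -
    (s j - gradient F (y j)) with hw
  have hxw : ∀ j, gradient (f j) (x j) - gradient (f j) z + μ • (x j - z) = w j := by
    intro j
    have h := gradient_add_smul_eq (hf j).differentiable (hx j)
    rw [hw, ← sub_eq_zero, ← sub_eq_zero.mpr (h.trans hz.symm)]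
    module
  set U := stackNorm fun j => x j - z with hU
  have hU0 : 0 ≤ U := stackNorm_nonneg _
  have hUw : (σ + μ) * U ≤ stackNorm w := by
    have h := stackNorm_le_mul (v := fun j => x j - z) (w := w) (c := (σ + μ)⁻¹) (by positivity)
      (fun j => by
        rw [inv_mul_eq_div, le_div_iff₀ hM, mul_comm]
        exact (hf j).mul_norm_sub_le (hxw j))
    rwa [inv_mul_eq_div, le_div_iff₀ hM, mul_comm] at h
  have hwb : stackNorm w ≤ μ * stackNorm (fun j => y j - avg y) +
      homogeneity f * (stackNorm (fun j => y j - avg y) + Real.sqrt n * ‖z - avg y‖) +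
      stackNorm (fun j => s j - gradient F (y j)) := by
    have e : w = fun j => (μ • (y j - avg y) +
        ((gradient (f j) (y j) - gradient F (y j)) - (gradient (f j) z - gradient F z))) +
        (gradient F (y j) - s j) := by
      funext j
      rw [hw]
      module
    rw [e, stackNorm_sub_comm s]
    refine (stackNorm_add_le _ _).trans (add_le_add_left ?_ _)
    refine (stackNorm_add_le _ _).trans (add_le_add ?_ ?_)
    · exact stackNorm_le_mul hμ.le fun j => by rw [norm_smul, Real.norm_of_nonneg hμ.le]
    · refine (stackNorm_le_mul (w := fun j => y j - z) hβ fun j =>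
        norm_gradient_sub_gradient_sub_le hn hσ hL hf j (y j) z).trans ?_
      gcongr
      have h := stackNorm_add_le (fun j => y j - avg y) (fun _ => avg y - z)
      rw [stackNorm_const, norm_sub_rev (avg y)] at h
      simpa using h
  -- Gradient tracking is used here: the averages of s_j and of ∇f_j(y_j) cancel.
  have hw0 : avg w = 0 := by
    have e1 : avg (fun j => y j - avg y) = 0 := by
      rw [avg, sum_sub_avg hn, smul_zero]
    have e2 : (fun j => w j) = fun j => μ • (y j - avg y) +
        ((gradient (f j) (y j) - s j) - (gradient (f j) z - gradient F z)) := by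
      funext j
      rw [hw]
      module
    change avg (fun j => w j) = 0
    rw [e2, avg_add, avg_smul, e1, avg_sub, avg_sub, avg_sub, htrack, avg_const hn, ← hgF]
    simp
  -- As w averages to 0, x̄ - z is governed by gradient differences alone. Subtracting σ(x_j - z)
  -- makes the divisor σ + μ instead of μ, at the cost of L + σ ≤ 2L.
  have hxz : Real.sqrt n * ‖avg x - z‖ ≤ 2 * (L / (σ + μ)) * U := by
    set e : Fin n → Vec d := fun j =>
      (gradient (f j) (x j) - gradient (f j) z) - σ • (x j - z) with he
    have h1 : avg e = -((σ + μ) • (avg x - z)) := by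
      have e3 : e = fun j => w j - (σ + μ) • (x j - z) := by
        funext j
        rw [he, ← hxw j]
        module
      rw [e3, avg_sub w fun j => (σ + μ) • (x j - z), avg_smul, avg_sub x, avg_const hn, hw0,
        zero_sub]
    have h2 : stackNorm e ≤ 2 * L * U := by
      refine stackNorm_le_mul (by positivity) fun j => ?_
      refine (norm_sub_le _ _).trans ?_
      have h3 := (hf j).norm_gradient_sub_le hσ hL (x j) z
      rw [norm_smul, Real.norm_of_nonneg hσ.le]
      nlinarith [norm_nonneg (x j - z)]
    have h3 := (sqrt_mul_norm_avg_le hn e).trans h2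
    rw [h1, norm_neg, norm_smul, Real.norm_of_nonneg hM.le] at h3
    have h4 : 2 * (L / (σ + μ)) * U = (2 * L * U) / (σ + μ) := by ring
    rw [h4, le_div_iff₀ hM]
    linarith
  have hz3 : Real.sqrt n * ‖z - avg y‖ ≤ L / (σ + μ) * (Real.sqrt n * ‖avg y - yopt‖) := by
    have h : ‖z - avg y‖ ≤ L / (σ + μ) * ‖avg y - yopt‖ := by
      rw [div_mul_eq_mul_div, le_div_iff₀ hM]
      linarith
    calc _ ≤ Real.sqrt n * (L / (σ + μ) * ‖avg y - yopt‖) := by gcongr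
      _ = _ := by ring
  refine ⟨U, hU0, stackNorm_sub_avg_le hn x z, ?_, ?_, ?_⟩
  · have hb := stackNorm_nonneg fun j => y j - avg y
    set b := stackNorm fun j => y j - avg y
    set c := stackNorm fun j => s j - gradient F (y j)
    set a := Real.sqrt n * ‖avg y - yopt‖
    have h1 : (σ + μ) * U ≤ (σ + μ) * b + homogeneity f * (b + L / (σ + μ) * a) + c := by
      refine (hUw.trans hwb).trans ?_
      gcongr
      linarith
    have h2 : (1 + homogeneity f / (σ + μ)) * b + homogeneity f / (σ + μ) * (L / (σ + μ)) * a +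
        L / (σ + μ) * (L⁻¹ * c) =
        ((σ + μ) * b + homogeneity f * (b + L / (σ + μ) * a) + c) / (σ + μ) := by
      field_simp
      ring
    rw [h2, le_div_iff₀ hM]
    linarith
  · have h : ‖z - yopt‖ ≤ (1 - σ / (σ + μ)) * ‖avg y - yopt‖ := by
      rw [one_sub_div hM.ne', add_sub_cancel_left, div_mul_eq_mul_div, le_div_iff₀ hM]
      linarith
    calc Real.sqrt n * ‖avg x - yopt‖ ≤ Real.sqrt n * (‖avg x - z‖ + ‖z - yopt‖) := by
          gcongr
          exact norm_sub_le_norm_sub_add_norm_sub _ _ _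
      _ ≤ Real.sqrt n * ‖avg x - z‖ +
          Real.sqrt n * ((1 - σ / (σ + μ)) * ‖avg y - yopt‖) := by
          rw [mul_add]
          gcongr
      _ ≤ _ := by linarith
  · calc Real.sqrt n * ‖avg x - avg y‖ ≤ Real.sqrt n * (‖avg x - z‖ + ‖z - avg y‖) := by
          gcongr
          exact norm_sub_le_norm_sub_add_norm_sub _ _ _
      _ ≤ _ := by linarith

variable {G : SimpleGraph (Fin n)} {W : Matrix (Fin n) (Fin n) ℝ} {K : ℕ}

/-- Gradient tracking: one iteration keeps the average of the gradient estimates equal to the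
average of the local gradients. -/
theorem IsStep.avg_s_eq (hW : IsMixing G W) {p q : State n d}
    (h : IsStep f W K μ p q) (hp : avg p.s = avg fun j => gradient (f j) (p.y j)) :
    avg q.s = avg fun j => gradient (f j) (q.y j) := by
  have hs : q.s = fun j => (mix W)^[K] p.s j +
      (gradient (f j) (q.y j) - gradient (f j) (p.y j)) := by
    funext j
    rw [h.s_eq j, gossip_iterate]
  rw [hs, avg_add, avg_sub]
  change avg ((mix W)^[K] p.s) + _ = _
  rw [hW.avg_mix_iterate, hp]
  abel

/-- The effect of the communication rounds and of the gradient tracking step. -/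
theorem IsStep.mixing_bounds (hn : 0 < n) (hσ : 0 < σ) (hL : σ ≤ L)
    (hf : ∀ j, HessianBetween σ L (f j)) (hW : IsMixing G W) {p q : State n d}
    (h : IsStep f W K μ p q) (hp : avg p.s = avg fun j => gradient (f j) (p.y j))
    {α : ℝ} (hα : mixingRate W ^ K ≤ α) :
    avg q.y = avg p.x ∧
    stackNorm (fun j => q.y j - avg q.y) ≤ α * stackNorm (fun j => p.x j - avg p.x) ∧
    (L⁻¹ * stackNorm fun j => q.s j - gradient (globalLoss f) (q.y j)) ≤
      α * ((L⁻¹ * stackNorm fun j => p.s j - gradient (globalLoss f) (p.y j)) +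
        stackNorm fun j => p.y j - avg p.y) +
      homogeneity f / L * stackNorm (fun j => p.y j - avg p.y) +
      stackNorm (fun j => p.y j - avg p.y) +
      homogeneity f / L * (stackNorm (fun j => q.y j - avg q.y) +
        stackNorm (fun j => p.y j - avg p.y) + Real.sqrt n * ‖avg p.x - avg p.y‖) := by
  have hL0 : 0 < L := hσ.trans_le hL
  have hβ : 0 ≤ homogeneity f := homogeneity_nonneg
  have hα0 : 0 ≤ α := le_trans (pow_nonneg (norm_nonneg _) K) hα
  have hF := HessianBetween.globalLoss hn hf
  set F := globalLoss f
  have hgF : ∀ z, gradient F z = avg fun j => gradient (f j) z := fun z =>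
    congrFun (gradient_globalLoss fun j => (hf j).differentiable) z
  have hy : q.y = (mix W)^[K] p.x := by rw [h.y_eq, gossip_iterate]
  have hs : ∀ j, q.s j = (mix W)^[K] p.s j +
      (gradient (f j) (q.y j) - gradient (f j) (p.y j)) := by
    intro j
    rw [h.s_eq j, gossip_iterate]
  have hmix : ∀ v : Fin n → Vec d, stackNorm (fun j => (mix W)^[K] v j - avg v) ≤
      α * stackNorm (fun j => v j - avg v) := fun v =>
    (hW.stackNorm_mix_iterate_sub_avg_le hn K v).trans
      (mul_le_mul_of_nonneg_right hα (stackNorm_nonneg _))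
  have hya : avg q.y = avg p.x := by rw [hy, hW.avg_mix_iterate]
  have hyb : stackNorm (fun j => q.y j - avg q.y) ≤
      α * stackNorm (fun j => p.x j - avg p.x) := by
    rw [hya, hy]
    exact hmix p.x
  refine ⟨hya, hyb, ?_⟩
  set b := stackNorm fun j => p.y j - avg p.y with hb
  set c := stackNorm fun j => p.s j - gradient F (p.y j) with hc
  set g : Fin n → Vec d := fun j => gradient F (p.y j) with hg
  have hgb : stackNorm (fun j => g j - gradient F (avg p.y)) ≤ L * b :=
    stackNorm_le_mul hL0.le fun j => hF.norm_gradient_sub_le hσ hL _ _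
  have hsb : stackNorm (fun j => p.s j - avg p.s) ≤ c + L * b := by
    refine (stackNorm_sub_avg_le hn p.s (gradient F (avg p.y))).trans ?_
    have h1 := stackNorm_add_le (fun j => p.s j - g j) (fun j => g j - gradient F (avg p.y))
    simp only [sub_add_sub_cancel] at h1
    linarith
  have hsg : Real.sqrt n * ‖avg p.s - avg g‖ ≤ homogeneity f * b := by
    have e : avg p.s - avg g = avg fun j => (gradient (f j) (p.y j) - gradient F (p.y j)) -
        (gradient (f j) (avg p.y) - gradient F (avg p.y)) := by
      rw [avg_sub, avg_sub, avg_sub, ← hp, ← hgF, avg_const hn, sub_self, sub_zero]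
    rw [e]
    exact (sqrt_mul_norm_avg_le hn _).trans (stackNorm_le_mul hβ fun j =>
      norm_gradient_sub_gradient_sub_le hn hσ hL hf j _ _)
  have hqp : stackNorm (fun j => q.y j - p.y j) ≤ stackNorm (fun j => q.y j - avg q.y) + b +
      Real.sqrt n * ‖avg p.x - avg p.y‖ := by
    have h1 := stackNorm_add_le (fun j => (q.y j - avg q.y) + (avg p.y - p.y j))
      (fun _ => avg q.y - avg p.y)
    have h2 := stackNorm_add_le (fun j => q.y j - avg q.y) (fun j => avg p.y - p.y j)
    rw [stackNorm_const] at h1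
    have e : (fun j => (q.y j - avg q.y) + (avg p.y - p.y j) + (avg q.y - avg p.y)) =
        fun j => q.y j - p.y j := by
      funext j
      abel
    rw [e] at h1
    rw [stackNorm_sub_comm (fun _ => avg p.y) p.y] at h2
    rw [← hya]
    linarith
  have hmain : stackNorm (fun j => q.s j - gradient F (q.y j)) ≤
      α * (c + L * b) + homogeneity f * b + L * b +
        homogeneity f * stackNorm (fun j => q.y j - p.y j) := by
    -- Four errors: imperfect mixing of s, bias of its average, spread of the global gradients, and
    -- the change of ∇f_j - ∇f between the old and new y. Pairing the last terms this way makes the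
    -- displacement cost β rather than L.
    have e : (fun j => q.s j - gradient F (q.y j)) = fun j =>
        (((mix W)^[K] p.s j - avg p.s) + (avg p.s - avg g) + (avg g - g j)) +
        ((gradient (f j) (q.y j) - gradient F (q.y j)) -
          (gradient (f j) (p.y j) - gradient F (p.y j))) := by
      funext j
      rw [hs j]
      simp only [hg]
      abel
    rw [e]
    refine (stackNorm_add_le _ _).trans (add_le_add ?_ (stackNorm_le_mul hβ fun j =>
      norm_gradient_sub_gradient_sub_le hn hσ hL hf j _ _))
    refine (stackNorm_add_le _ _).trans (add_le_add ?_ ?_)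
    · refine (stackNorm_add_le _ _).trans (add_le_add ?_ ?_)
      · exact (hmix p.s).trans (by gcongr)
      · rwa [stackNorm_const]
    · rw [stackNorm_sub_comm (fun _ => avg g) g]
      exact (stackNorm_sub_avg_le hn g _).trans hgb
  rw [inv_mul_eq_div, div_le_iff₀ hL0]
  refine hmain.trans ((add_le_add_right (mul_le_mul_of_nonneg_left hqp hβ) _).trans
    (le_of_eq ?_))
  field_simp

end OneStep

end NetworkDane

namespace NetworkDane

/-! ### The scalar recursion -/

section Recursion

/-- Contraction of the weighted error in one iteration. -/
theorem weighted_error_contraction {a b c U a' b' c' k l q r h : ℝ} (ha : 0 ≤ a) (hb : 0 ≤ b)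
    (hc : 0 ≤ c) (hU0 : 0 ≤ U) (hl0 : 0 ≤ l) (hl : l ≤ 1 / 360) (hk0 : 0 ≤ k) (hk : k ≤ 1)
    (hq : q ≤ k / 360) (hh0 : 0 ≤ h) (hh : h ≤ 2) (hr : r = k * l)
    (hqh : q = h * l) (hU : U ≤ (1 + q) * b + q * l * a + l * c)
    (h1 : a' ≤ (1 - r) * a + 2 * l * U) (h2 : b' ≤ k / 2 * U)
    (h3 : c' ≤ k / 2 * (c + b) + h * b + b + h * (b' + b + (2 * l * U + l * a))) :
    a' + b' + 2 * l * c' ≤ (1 - r / 2) * (a + b + 2 * l * c) ∧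
      c' ≤ 3 / 5 * c + 7 * (a + b + 2 * l * c) := by
  have hr0 : 0 ≤ r := by rw [hr]; positivity
  have hr1 : r ≤ 1 / 360 := by rw [hr]; nlinarith
  have hql : q * l ≤ r / 360 := by rw [hr]; nlinarith
  have hqla : q * l * a ≤ r / 360 * a := by gcongr
  have hra : 0 ≤ r * a := by positivity
  have hra1 : r * a ≤ 1 / 360 * a := by gcongr
  have hlc : 0 ≤ l * c := by positivity
  have hlc1 : l * c ≤ 1 / 360 * c := by gcongr
  have hrlc : r * (l * c) ≤ 1 / 360 * (l * c) := by gcongr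
  have hrb : r * b ≤ 1 / 360 * b := by gcongr
  have hlb : l * b ≤ 1 / 360 * b := by gcongr
  have hqb : q * b ≤ 1 / 360 * b := by
    gcongr
    linarith
  have hU1 : U ≤ 361 / 360 * b + r / 360 * a + l * c := by linarith
  have hlU : l * U ≤ 1 / 360 * U := by gcongr
  have hb1 : b' ≤ 1 / 2 * U := h2.trans (by gcongr)
  have hS : c' ≤ 1 / 2 * (c + b) + 2 * b + b + 2 * (1 / 2 * U + b + 2 * l * U) + q * a := by
    have e1 : k / 2 * (c + b) ≤ 1 / 2 * (c + b) := by gcongr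
    have e2 : h * b ≤ 2 * b := by gcongr
    have e3 : h * (b' + b + (2 * l * U + l * a)) ≤
        2 * (1 / 2 * U + b + 2 * l * U) + q * a := by
      calc _ ≤ h * (1 / 2 * U + b + 2 * l * U) + h * l * a := by
            have : h * b' ≤ h * (1 / 2 * U) := by gcongr
            linarith
        _ ≤ _ := by
            rw [hqh]
            gcongr
    linarith
  have hqa : q * a ≤ 1 / 360 * a := by
    gcongr
    linarith
  refine ⟨?_, by linarith⟩
  -- The weight 2l leaves room for c: about l/2 of it returns through b' and l through c', together
  -- below 2l. The terms in b carry a factor l ≤ 1/360.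
  have hS2 : 2 * l * c' ≤ l * c + l * b + 10 * (l * b) + 3 * (l * U) + 2 * (q * l * a) := by
    have e := mul_le_mul_of_nonneg_left hS (show 0 ≤ 2 * l by positivity)
    have e4 : l * (l * U) ≤ 1 / 360 * (l * U) := by gcongr
    have : 0 ≤ l * U := by positivity
    nlinarith
  linarith

/-- The recursion starts at index 1, since no local minimization precedes the first communication.
The constant 60 is preserved because (3/5)·60 + 7·2 = 50 ≤ 60(1 - r/2). -/
theorem geometric_decay {a b c : ℕ → ℝ} {l r E : ℝ} (hr : r ≤ 1 / 360)
    (hE : 0 ≤ E) (hl0 : 0 ≤ l) (ha : ∀ t, 0 ≤ a t) (hb : ∀ t, 0 ≤ b t) (hc : ∀ t, 0 ≤ c t)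
    (h0 : max (a 0) (max (b 0) (c 0)) ≤ E)
    (h1 : a 1 + b 1 + 2 * l * c 1 ≤ 2 * E) (h1c : c 1 ≤ 7 * E)
    (hV : ∀ t, a (t + 2) + b (t + 2) + 2 * l * c (t + 2) ≤
      (1 - r / 2) * (a (t + 1) + b (t + 1) + 2 * l * c (t + 1)))
    (hC : ∀ t, c (t + 2) ≤ 3 / 5 * c (t + 1) +
      7 * (a (t + 1) + b (t + 1) + 2 * l * c (t + 1))) (t : ℕ) :
    max (a t) (max (b t) (c t)) ≤ 100 * E * (1 - r / 2) ^ t := by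
  have hρ : 0 ≤ 1 - r / 2 := by linarith
  cases t with
  | zero =>
    rw [pow_zero]
    linarith
  | succ t =>
    have key : a (t + 1) + b (t + 1) + 2 * l * c (t + 1) ≤ 2 * E * (1 - r / 2) ^ t ∧
        c (t + 1) ≤ 60 * E * (1 - r / 2) ^ t := by
      induction t with
      | zero => exact ⟨by simpa using h1, by simpa using h1c.trans (by linarith)⟩
      | succ t ih =>
        have hP : 0 ≤ E * (1 - r / 2) ^ t := by positivity
        refine ⟨(hV t).trans ?_, (hC t).trans ?_⟩
        · rw [pow_succ']
          nlinarith [ih.1]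
        · rw [pow_succ']
          nlinarith [ih.1, ih.2]
    have hP : 0 ≤ E * (1 - r / 2) ^ t := by positivity
    have hlc : 0 ≤ 2 * l * c (t + 1) := by
      have := hc (t + 1)
      positivity
    -- Passing from 60 to 100 pays for the shift of the exponent by one.
    have hbig : 60 * E * (1 - r / 2) ^ t ≤ 100 * E * (1 - r / 2) ^ (t + 1) := by
      rw [pow_succ']
      nlinarith
    refine le_trans ?_ hbig
    refine max_le ?_ (max_le ?_ key.2) <;>
      linarith [key.1, ha (t + 1), hb (t + 1)]

end Recursion

/-! ### Counting iterations and communication rounds -/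

section Complexity

theorem one_half_le_log_two_mul {κ : ℝ} (hκ : 1 ≤ κ) : 1 / 2 ≤ Real.log (2 * κ) := by
  have h1 := Real.log_two_gt_d9
  have h2 : Real.log 2 ≤ Real.log (2 * κ) := Real.log_le_log two_pos (by linarith)
  linarith

/-- The least number of rounds that mixes well is at most of the order of
`log (2 κ) / (1 - α₀)`. -/
theorem least_rounds_le {α κ : ℝ} (hα0 : 0 ≤ α) (hα : α < 1) (hκ : 1 ≤ κ) {K₀ : ℕ}
    (hK : IsLeast {k : ℕ | α ^ k ≤ 1 / (2 * κ)} K₀) :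
    (K₀ : ℝ) ≤ 3 * (Real.log (2 * κ) / (1 - α)) := by
  have hlog := one_half_le_log_two_mul hκ
  have h1α : 0 < 1 - α := by linarith
  have hone : 1 ≤ 2 * (Real.log (2 * κ) / (1 - α)) := by
    rw [← mul_div_assoc, le_div_iff₀ h1α]
    linarith
  rcases Nat.eq_zero_or_pos K₀ with h0 | h0
  · rw [h0, Nat.cast_zero]
    linarith
  obtain ⟨m, rfl⟩ := Nat.exists_eq_succ_of_ne_zero h0.ne'
  -- By minimality the predecessor of K₀ mixes too little, so m(1 - α) ≤ log(2κ); the extra round is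
  -- absorbed by `hone`.
  have hm : 1 / (2 * κ) < α ^ m := by
    by_contra hcon
    have : m + 1 ≤ m := hK.2 (not_lt.mp hcon)
    omega
  have h2 : α ^ m ≤ Real.exp (-(m * (1 - α))) := by
    have := Real.one_sub_le_exp_neg (1 - α)
    rw [sub_sub_cancel] at this
    calc α ^ m ≤ Real.exp (-(1 - α)) ^ m := by gcongr
      _ = _ := by rw [← Real.exp_nat_mul]; ring_nf
  have h3 : (m : ℝ) * (1 - α) ≤ Real.log (2 * κ) := by
    have h4 := Real.log_le_log (by positivity) (hm.le.trans h2)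
    rw [Real.log_exp, one_div, Real.log_inv] at h4
    linarith
  have h5 : (m : ℝ) ≤ Real.log (2 * κ) / (1 - α) := by rwa [le_div_iff₀ h1α]
  push_cast
  linarith

/-- The number of iterations after which a geometrically decaying error is small. -/
theorem exists_iterations {e : ℕ → ℝ} {E ε r R : ℝ} (hE : 0 ≤ E) (hε : 0 < ε) (hr0 : 0 < r)
    (hr : r ≤ 1) (hR : 1 / r ≤ R) (he : ∀ t, e t ≤ 100 * E * (1 - r / 2) ^ t) :
    ∃ T : ℕ, (∀ t, T ≤ t → e t ≤ ε) ∧ (T : ℝ) ≤ 18 * R * Real.log (2 + E / ε) := by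
  have hx : 2 ≤ 2 + E / ε := by
    have : 0 ≤ E / ε := by positivity
    linarith
  set X := 2 + E / ε with hX
  have hX0 : 0 < X := by linarith
  have hlog : 1 / 2 ≤ Real.log X := by
    have h1 := Real.log_two_gt_d9
    have h2 : Real.log 2 ≤ Real.log X := Real.log_le_log two_pos hx
    linarith
  have hR1 : 1 ≤ R := le_trans (by rw [le_div_iff₀ hr0]; linarith) hR
  -- One factor X covers E/ε and 2⁷ ≥ 100 covers the constant, so decay to X⁻⁸ suffices.
  have h100 : 100 * X ≤ X ^ 8 := by
    have : (2 : ℝ) ^ 7 ≤ X ^ 7 := by gcongr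
    nlinarith
  refine ⟨⌈16 * R * Real.log X⌉₊, fun t ht => ?_, ?_⟩
  · have ht' : 16 * R * Real.log X ≤ t := Nat.ceil_le.mp ht
    have hrt : 8 * Real.log X ≤ r / 2 * t := by
      have h1 : 1 ≤ R * r := by rwa [div_le_iff₀ hr0] at hR
      have h2 : r / 2 * (16 * R * Real.log X) ≤ r / 2 * t := by gcongr
      nlinarith
    have h1 : (1 - r / 2) ^ t ≤ (X ^ 8)⁻¹ := by
      have h2 := Real.one_sub_le_exp_neg (r / 2)
      calc (1 - r / 2) ^ t ≤ Real.exp (-(r / 2)) ^ t := by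
            gcongr
            linarith
        _ = Real.exp (-(r / 2 * t)) := by rw [← Real.exp_nat_mul]; ring_nf
        _ ≤ Real.exp (-(8 * Real.log X)) := by gcongr
        _ = (X ^ 8)⁻¹ := by
            rw [Real.exp_neg, mul_comm, Real.exp_mul, Real.exp_log hX0]
            norm_cast
    have h3 : E ≤ ε * X := by
      rw [hX, mul_add, mul_div_cancel₀ _ hε.ne']
      linarith
    have hp : 0 ≤ (1 - r / 2) ^ t := pow_nonneg (by linarith) t
    calc e t ≤ 100 * E * (1 - r / 2) ^ t := he t
      _ ≤ 100 * (ε * X) * (X ^ 8)⁻¹ := by gcongr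
      _ = ε * ((100 * X) / X ^ 8) := by ring
      _ ≤ ε * 1 := by
          gcongr
          rw [div_le_one (by positivity)]
          exact h100
      _ = ε := mul_one ε
  · have h1 := (Nat.ceil_lt_add_one (show 0 ≤ 16 * R * Real.log X by positivity)).le
    nlinarith

end Complexity

end NetworkDane

namespace NetworkDane

/-! ### Linear convergence of a run -/

section Convergence

variable {n d : ℕ} {σ L μ : ℝ} {f : Fin n → Vec d → ℝ} {G : SimpleGraph (Fin n)}
  {W : Matrix (Fin n) (Fin n) ℝ} {K : ℕ}

theorem IsRun.avg_s_eq (hW : IsMixing G W) {p : ℕ → State n d}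
    (hp : IsRun f W K μ p) (t : ℕ) : avg (p t).s = avg fun j => gradient (f j) ((p t).y j) := by
  induction t with
  | zero => exact congrArg avg (funext hp.init.s_eq)
  | succ t ih => exact (hp.step t).avg_s_eq hW ih

theorem IsRun.rounds_eq {p : ℕ → State n d} (hp : IsRun f W K μ p) (t : ℕ) :
    (p t).rounds = t * K := by
  induction t with
  | zero => simp [hp.init.rounds_eq]
  | succ t ih =>
    rw [(hp.step t).rounds_eq, gossip_iterate, ih]
    ring

/-- The scalar recursion is applied with k = σ/L, l = L/(σ+μ), q = β/(σ+μ), h = β/L and r = σ/(σ+μ)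
= kl. The condition on μ is used as 360L ≤ σ+μ and 360Lβ ≤ σ(σ+μ), that is l ≤ 1/360 and q ≤ k/360.
-/
theorem IsRun.err_le (hn : 0 < n) (hσ : 0 < σ) (hL : σ ≤ L)
    (hf : ∀ j, HessianBetween σ L (f j)) (hW : IsMixing G W) {yopt : Vec d}
    (hopt : IsMinOn (globalLoss f) Set.univ yopt)
    (hα : mixingRate W ^ K ≤ 1 / (2 * (L / σ)))
    (hμ : 360 * L * (homogeneity f / σ + 1) ≤ σ + μ) {p : ℕ → State n d}
    (hp : IsRun f W K μ p) (t : ℕ) :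
    err f L yopt (p t) ≤ 100 * err f L yopt (p 0) * (1 - σ / (σ + μ) / 2) ^ t := by
  have hL0 : 0 < L := hσ.trans_le hL
  have hβ : 0 ≤ homogeneity f := homogeneity_nonneg
  have hβL := homogeneity_le hn hσ hL hf
  have hLM : 360 * L ≤ σ + μ := by
    refine le_trans ?_ hμ
    have : 0 ≤ homogeneity f / σ := by positivity
    nlinarith
  have hμ0 : 0 < μ := by linarith
  have hM : 0 < σ + μ := by linarith
  have hβM : 360 * L * homogeneity f ≤ σ * (σ + μ) := by
    have h : σ * (360 * L * (homogeneity f / σ + 1)) =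
        360 * L * homogeneity f + 360 * L * σ := by
      field_simp
    have := mul_le_mul_of_nonneg_left hμ hσ.le
    have : 0 ≤ 360 * L * σ := by positivity
    linarith
  have hk0 : 0 ≤ σ / L := by positivity
  have hk1 : σ / L ≤ 1 := (div_le_one hL0).mpr hL
  have hα' : mixingRate W ^ K ≤ σ / L / 2 := by
    refine hα.trans (le_of_eq ?_)
    field_simp
  have hl0 : 0 ≤ L / (σ + μ) := by positivity
  have hl : L / (σ + μ) ≤ 1 / 360 := by
    rw [div_le_div_iff₀ hM (by norm_num)]
    linarith
  have hq : homogeneity f / (σ + μ) ≤ σ / L / 360 := by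
    rw [div_div, div_le_div_iff₀ hM (by positivity)]
    linarith
  have hh0 : 0 ≤ homogeneity f / L := by positivity
  have hh : homogeneity f / L ≤ 2 := (div_le_iff₀ hL0).mpr hβL
  have hr1 : σ / (σ + μ) ≤ 1 / 360 := by
    rw [div_le_div_iff₀ hM (by norm_num)]
    linarith
  have hr : σ / (σ + μ) = σ / L * (L / (σ + μ)) := by field_simp
  have hqh : homogeneity f / (σ + μ) = homogeneity f / L * (L / (σ + μ)) := by field_simp
  set a : ℕ → ℝ := fun t => Real.sqrt n * ‖avg (p t).y - yopt‖ with ha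
  set b : ℕ → ℝ := fun t => stackNorm fun j => (p t).y j - avg (p t).y with hb
  set c : ℕ → ℝ := fun t =>
    L⁻¹ * stackNorm fun j => (p t).s j - gradient (globalLoss f) ((p t).y j) with hc
  have ha0 : ∀ t, 0 ≤ a t := fun t => by positivity
  have hb0 : ∀ t, 0 ≤ b t := fun t => stackNorm_nonneg _
  have hc0 : ∀ t, 0 ≤ c t := fun t => mul_nonneg (by positivity) (stackNorm_nonneg _)
  have herr : ∀ t, err f L yopt (p t) = max (a t) (max (b t) (c t)) := fun t => rfl
  have hmix : ∀ t, a (t + 1) = Real.sqrt n * ‖avg (p t).x - yopt‖ ∧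
      b (t + 1) ≤ σ / L / 2 * stackNorm (fun j => (p t).x j - avg (p t).x) ∧
      c (t + 1) ≤ σ / L / 2 * (c t + b t) + homogeneity f / L * b t + b t +
        homogeneity f / L * (b (t + 1) + b t + Real.sqrt n * ‖avg (p t).x - avg (p t).y‖) := by
    intro t
    obtain ⟨h1, h2, h3⟩ := (hp.step t).mixing_bounds hn hσ hL hf hW (hp.avg_s_eq hW t) hα'
    exact ⟨by simp only [ha, h1], h2, h3⟩
  have hstep : ∀ t, a (t + 2) + b (t + 2) + 2 * (L / (σ + μ)) * c (t + 2) ≤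
      (1 - σ / (σ + μ) / 2) * (a (t + 1) + b (t + 1) + 2 * (L / (σ + μ)) * c (t + 1)) ∧
      c (t + 2) ≤ 3 / 5 * c (t + 1) +
        7 * (a (t + 1) + b (t + 1) + 2 * (L / (σ + μ)) * c (t + 1)) := by
    intro t
    obtain ⟨U, hU0, hU1, hU2, hU3, hU4⟩ := local_minimization_bounds hn hσ hL hf hopt hμ0
      (hp.avg_s_eq hW (t + 1)) (hp.step t).x_min
    obtain ⟨m1, m2, m3⟩ := hmix (t + 1)
    refine weighted_error_contraction (ha0 _) (hb0 _) (hc0 _) hU0 hl0 hl hk0 hk1 hq hh0 hh hr hqh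
      hU2 (m1.le.trans hU3) (m2.trans ?_) (m3.trans ?_)
    · gcongr
    · gcongr
  have hE : 0 ≤ err f L yopt (p 0) := (ha0 0).trans (le_max_left _ _)
  have hE' : max (a 0) (max (b 0) (c 0)) ≤ err f L yopt (p 0) := le_rfl
  obtain ⟨m1, m2, m3⟩ := hmix 0
  -- Initially x = y, so the first iteration only mixes and tracks: a is unchanged and the
  -- displacement of the average vanishes.
  rw [← hp.init.y_eq] at m1 m2 m3
  rw [sub_self, norm_zero, mul_zero, add_zero] at m3
  have m1' : a 1 = a 0 := m1
  have m2' : b 1 ≤ σ / L / 2 * b 0 := m2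
  rw [zero_add] at m3
  obtain ⟨e1, e2⟩ := max_le_iff.mp hE'
  obtain ⟨e2, e3⟩ := max_le_iff.mp e2
  have hb1 : b 1 ≤ 1 / 2 * b 0 := m2'.trans (by
    have := hb0 0
    gcongr)
  have hc1 : c 1 ≤ 7 * err f L yopt (p 0) := by
    have f1 : σ / L / 2 * (c 0 + b 0) ≤ 1 / 2 * (c 0 + b 0) := by
      have := hb0 0
      have := hc0 0
      gcongr
    have f2 : homogeneity f / L * b 0 ≤ 2 * b 0 := by
      have := hb0 0
      gcongr
    have f3 : homogeneity f / L * (b 1 + b 0) ≤ 2 * (b 1 + b 0) := by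
      have := hb0 0
      have := hb0 1
      gcongr
    linarith
  rw [herr t]
  refine geometric_decay hr1 hE hl0 ha0 hb0 hc0 hE' ?_ hc1
    (fun t => (hstep t).1) (fun t => (hstep t).2) t
  have hlc : L / (σ + μ) * c 1 ≤ 1 / 360 * c 1 := by
    have := hc0 1
    gcongr
  linarith

end Convergence

end NetworkDane

theorem theorem4 :
    ∃ C : ℝ, 1 ≤ C ∧
      ∀ (n d : ℕ) (_ : 0 < n)
        (G : SimpleGraph (Fin n)) (W : Matrix (Fin n) (Fin n) ℝ) (_ : NetworkDane.IsMixing G W)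
        (_ : NetworkDane.mixingRate W < 1)
        (f : Fin n → NetworkDane.Vec d → ℝ) (σ L : ℝ) (_ : 0 < σ) (_ : σ ≤ L)
        (_ : ∀ j, NetworkDane.HessianBetween σ L (f j))
        (yopt : NetworkDane.Vec d) (_ : IsMinOn (NetworkDane.globalLoss f) Set.univ yopt)
        (K : ℕ) (_ : NetworkDane.mixingRate W ^ K ≤ 1 / (2 * (L / σ)))
        (μ : ℝ) (_ : 360 * L * (NetworkDane.homogeneity f / σ + 1) ≤ σ + μ)
        (p : ℕ → NetworkDane.State n d) (_ : NetworkDane.IsRun f W K μ p),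
        (∀ t : ℕ, NetworkDane.err f L yopt (p t) ≤
          C * NetworkDane.err f L yopt (p 0) * (1 - σ / (C * (σ + μ))) ^ t) ∧
        ∀ Λ : ℝ, 1 ≤ Λ → σ + μ ≤ Λ * (360 * L * (NetworkDane.homogeneity f / σ + 1)) →
          ∀ ε : ℝ, 0 < ε →
            ∃ T : ℕ,
              (∀ t : ℕ, T ≤ t → NetworkDane.err f L yopt (p t) ≤ ε) ∧
              (T : ℝ) ≤ C * Λ * ((L / σ) * (NetworkDane.homogeneity f / σ + 1)) *
                Real.log (2 + NetworkDane.err f L yopt (p 0) / ε) ∧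
              ∀ K₀ : ℕ, IsLeast {k : ℕ | NetworkDane.mixingRate W ^ k ≤ 1 / (2 * (L / σ))} K₀ →
                (K : ℝ) ≤ Λ * K₀ →
                ((p T).rounds : ℝ) ≤ C * Λ ^ 2 * (Real.log (2 * (L / σ)) *
                  ((L / σ) * (NetworkDane.homogeneity f / σ + 1) *
                    Real.log (2 + NetworkDane.err f L yopt (p 0) / ε) /
                      (1 - NetworkDane.mixingRate W))) := by
  -- The round count is the most demanding: 18 · 360 · 3 = 19440.
  refine ⟨20000, by norm_num, ?_⟩
  intro n d hn G W hW hα1 f σ L hσ hL hf yopt hopt K hα μ hμ p hp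
  have hL0 : 0 < L := hσ.trans_le hL
  have hβ : 0 ≤ NetworkDane.homogeneity f := NetworkDane.homogeneity_nonneg
  have hB : 1 ≤ NetworkDane.homogeneity f / σ + 1 := by
    have : 0 ≤ NetworkDane.homogeneity f / σ := by positivity
    linarith
  have hLM : 360 * L ≤ σ + μ := by
    refine le_trans ?_ hμ
    nlinarith
  have hM : 0 < σ + μ := by linarith
  have hκ : 1 ≤ L / σ := (one_le_div hσ).mpr hL
  have hr0 : 0 < σ / (σ + μ) := by positivity
  have hr1 : σ / (σ + μ) ≤ 1 := (div_le_one hM).mpr (by linarith)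
  have hE : 0 ≤ NetworkDane.err f L yopt (p 0) :=
    le_trans (by positivity) (le_max_left _ _)
  have hmain := hp.err_le hn hσ hL hf hW hopt hα hμ
  refine ⟨fun t => (hmain t).trans ?_, ?_⟩
  · have h0 : 0 ≤ 1 - σ / (σ + μ) / 2 := by linarith
    have h1 : σ / (20000 * (σ + μ)) ≤ σ / (σ + μ) / 2 := by
      rw [mul_comm, ← div_div]
      gcongr
      norm_num
    gcongr
    norm_num
  · intro Λ hΛ hμΛ ε hε
    set B := NetworkDane.homogeneity f / σ + 1
    have hR : 1 / (σ / (σ + μ)) ≤ Λ * 360 * (L / σ * B) := by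
      rw [one_div_div, div_le_iff₀ hσ]
      refine hμΛ.trans (le_of_eq ?_)
      field_simp
    obtain ⟨T, hT, hTle⟩ := NetworkDane.exists_iterations hE hε hr0 hr1 hR hmain
    set X := Real.log (2 + NetworkDane.err f L yopt (p 0) / ε)
    have hX : 0 ≤ X := by
      have : 0 ≤ NetworkDane.err f L yopt (p 0) / ε := by positivity
      exact Real.log_nonneg (by linarith)
    have hQ : 0 ≤ Λ * (L / σ * B) * X := by positivity
    refine ⟨T, hT, ?_, fun K₀ hK₀ hK => ?_⟩
    · linarith
    · have hα0 : 0 ≤ NetworkDane.mixingRate W := norm_nonneg _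
      have h1α : 0 < 1 - NetworkDane.mixingRate W := by linarith
      have hK₀' := NetworkDane.least_rounds_le hα0 hα1 hκ hK₀
      have hlog := NetworkDane.one_half_le_log_two_mul hκ
      have hlog0 : 0 ≤ Real.log (2 * (L / σ)) := by linarith
      have hKle : (K : ℝ) ≤ Λ * (3 * (Real.log (2 * (L / σ)) /
          (1 - NetworkDane.mixingRate W))) := hK.trans (by gcongr)
      rw [hp.rounds_eq, Nat.cast_mul]
      calc (T : ℝ) * K ≤ (18 * (Λ * 360 * (L / σ * B)) * X) *
            (Λ * (3 * (Real.log (2 * (L / σ)) / (1 - NetworkDane.mixingRate W)))) := by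
            gcongr
        _ = 19440 * (Λ ^ 2 * (Real.log (2 * (L / σ)) *
            (L / σ * B * X / (1 - NetworkDane.mixingRate W)))) := by ring
        _ ≤ 20000 * (Λ ^ 2 * (Real.log (2 * (L / σ)) *
            (L / σ * B * X / (1 - NetworkDane.mixingRate W)))) := by
            gcongr
            norm_num
        _ = _ := by ring
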